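/- Let $L=2m+1$ be an odd number with $m \ge 1$ and let $N \ge 2$. The M-type Grover walk with $L$ states on the cycle $C_N$ with vertex set $\mathbf{Z}/N\mathbf{Z}$ is the quantum walk on $\mathcal{H}=\mathcal{H}_P\otimes\mathcal{H}_C$, where $\mathcal{H}_P$ is the complex Hilbert space with orthonormal basis $\{|x\rangle : x\in \mathbf{Z}/N\mathbf{Z}\}$ and $\mathcal{H}_C$ the one with orthonormal basis $\{|d\rangle : d\in\mathbf{Z},\ -m\le d\le m\}$ (the state $|d\rangle$ moves the walker by $d$), whose time-evolution operator is $U^{M,L}_N = SC$ with $$S(|x\rangle\otimes|d\rangle)=|x+d\rangle\otimes|d\rangle,\qquad C=\sum_{x\in\mathbf{Z}/N\mathbf{Z}}|x\rangle\langle x|\otimes A^{M,L}.$$ Here $A^{M,L}$ is the operator on $\mathcal{H}_C$ whose $L\times L$ matrix in the above basis has all diagonal entries equal to $-(2m-1)/L$ and all other entries equal to $2/L$. The period of the walk is $$T^{M,L}_N=\inf\{\,n\ge 1 : (U^{M,L}_N)^n=1\,\}\in\{1,2,3,\dots\}\cup\{\infty\},$$ with $\inf\emptyset=\infty$. **Theorem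 4.1.** Let $L\ge 3$ be a prime number. Then, for all $N\ge 2$, $$T^{M,L}_N=\begin{cases}2L, & N=L,\\ \infty, & N\ne L.\end{cases}$$ -/

import Mathlib

open scoped Kronecker

namespace GroverWalk

/-- The displacement of the `i`-th chirality state. The ordered basis
`(|← m⟩, …, |← 1⟩, |·⟩, |1 →⟩, …, |m →⟩)` of the chirality space, where `L = 2 m + 1` is odd, is
indexed by `i = 0, …, L - 1`, so that the `i`-th state moves the walker by `i - m`. -/
def displacement (L : ℕ) (i : Fin L) : ℤ := (i : ℤ) - (((L - 1) / 2 : ℕ) : ℤ)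

/-- The shift operator on the cycle with `N` vertices (the vertex set is `ZMod N`), as a matrix
with respect to the orthonormal basis `|x⟩ ⊗ |i⟩` of the state space:
`S (|x⟩ ⊗ |i⟩) = |x + displacement i⟩ ⊗ |i⟩`. The second index `q` is the basis vector that is
mapped, the first index `p` the coordinate of its image. -/
def shift (L N : ℕ) : Matrix (ZMod N × Fin L) (ZMod N × Fin L) ℂ :=
  Matrix.of fun p q =>
    if p = (q.1 + ((displacement L q.2 : ℤ) : ZMod N), q.2) then 1 else 0

/-- The coin operator `C = ∑ₓ |x⟩⟨x| ⊗ A` of a local coin operator `A`. -/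
def coin {L : ℕ} (N : ℕ) [NeZero N] (A : Matrix (Fin L) (Fin L) ℂ) :
    Matrix (ZMod N × Fin L) (ZMod N × Fin L) ℂ :=
  ∑ x : ZMod N, Matrix.single x x (1 : ℂ) ⊗ₖ A

/-- The time-evolution operator `U = S C` of the quantum walk with local coin operator `A`. -/
def evolution {L : ℕ} (N : ℕ) [NeZero N] (A : Matrix (Fin L) (Fin L) ℂ) :
    Matrix (ZMod N × Fin L) (ZMod N × Fin L) ℂ :=
  shift L N * coin N A

/-- The local coin operator of the M-type Grover walk with `L = 2 m + 1` states: the diagonal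
entries are `-(2 m - 1) / L = (2 - L) / L`, all other entries are `2 / L`. -/
noncomputable def coinM (L : ℕ) : Matrix (Fin L) (Fin L) ℂ :=
  Matrix.of fun i j => if i = j then (2 - (L : ℂ)) / L else 2 / L

/-- The period of a quantum walk with time-evolution operator `U`: the infimum of all `n ≥ 1` with
`U ^ n = 1`. It is taken in `ℕ∞`, so it is `⊤` (infinite) if there is no such `n`. -/
noncomputable def period {ι : Type*} [Fintype ι] [DecidableEq ι] (U : Matrix ι ι ℂ) : ℕ∞ :=
  sInf ((fun n : ℕ => (n : ℕ∞)) '' {n : ℕ | 1 ≤ n ∧ U ^ n = 1})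

/-- The period of the M-type Grover walk with `L` states on the cycle with `N` vertices. -/
noncomputable def periodM (L N : ℕ) [NeZero N] : ℕ∞ := period (evolution N (coinM L))

end GroverWalk

namespace GroverWalk

open Matrix

/-! If `N ≠ L`, primality gives `N ∤ L`. Were some power of `U` the identity, the trace of `U` on a
Fourier sector would be a sum of roots of unity, hence an algebraic integer. That trace is a
geometric sum with denominator `L`, and it forces `2(1 - η)/L` to be integral for a root of unity `η
≠ 1`, which `not_isIntegral_two_div_mul_one_sub` excludes. If `N = L`, the displacements run once
through `ZMod L`, so a Fourier transform in chirality too gives a basis that `U` permutes up to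
sign: `(k, r) ↦ (k, r + k)`. The shifts have order `L` and the signs double it. -/

theorem evolution_coinM_mulVec_apply (L N : ℕ) [NeZero N] (f : ZMod N × Fin L → ℂ)
    (x : ZMod N) (i : Fin L) :
    (evolution N (coinM L) *ᵥ f) (x, i) =
      2 / (L : ℂ) * ∑ j, f (x - (displacement L i : ZMod N), j)
        - f (x - (displacement L i : ZMod N), i) := by
  have hL : (L : ℂ) ≠ 0 := Nat.cast_ne_zero.mpr (Nat.ne_of_gt (Fin.pos i))
  have hcoin : ∀ y j, (coin N (coinM L) *ᵥ f) (y, j) =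
      2 / (L : ℂ) * ∑ l, f (y, l) - f (y, j) := by
    intro y j
    have hA : ∀ l, coinM L j l = 2 / (L : ℂ) - if j = l then 1 else 0 := by
      intro l
      simp only [coinM, Matrix.of_apply]
      split_ifs
      · field_simp
      · simp
    have hC : ∀ z l, coin N (coinM L) (y, j) (z, l) = if y = z then coinM L j l else 0 := by
      intro z l
      simp only [coin, Matrix.sum_apply, Matrix.kroneckerMap_apply, Matrix.single_apply]
      by_cases h : y = z
      · subst h; simp
      · simp only [h, if_false]
        refine Finset.sum_eq_zero fun c _ => ?_
        rw [if_neg, zero_mul]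
        rintro ⟨rfl, rfl⟩
        exact h rfl
    simp only [Matrix.mulVec, dotProduct, Fintype.sum_prod_type, hC, ite_mul, zero_mul]
    rw [Finset.sum_comm]
    simp [hA, sub_mul, Finset.mul_sum]
  rw [evolution, ← Matrix.mulVec_mulVec, ← hcoin]
  rw [Matrix.mulVec, dotProduct, Finset.sum_eq_single (x - (displacement L i : ZMod N), i)]
  · simp [shift]
  · rintro ⟨y, j⟩ _ hne
    simp only [shift, Matrix.of_apply]
    rw [if_neg, zero_mul]
    rintro h
    obtain ⟨h1, rfl⟩ := Prod.mk.inj h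
    apply hne
    rw [h1]
    simp
  · simp

/-- The matrix of the walk restricted to the states `e(x) v i`, where `e` is the standard additive
character. -/
noncomputable def momentumEvolution (L N : ℕ) [NeZero N] : Matrix (Fin L) (Fin L) ℂ :=
  Matrix.of fun i j => ZMod.stdAddChar (-(displacement L i : ZMod N)) * coinM L i j

theorem evolution_mulVec_planeWave (L N : ℕ) [NeZero N] (v : Fin L → ℂ) :
    evolution N (coinM L) *ᵥ (fun p => ZMod.stdAddChar p.1 * v p.2) =
      fun p => ZMod.stdAddChar p.1 * (momentumEvolution L N *ᵥ v) p.2 := by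
  ext ⟨x, i⟩
  have hL : (L : ℂ) ≠ 0 := Nat.cast_ne_zero.mpr (Nat.ne_of_gt (Fin.pos i))
  have hA : ∀ l, coinM L i l = 2 / (L : ℂ) - if i = l then 1 else 0 := by
    intro l
    simp only [coinM, Matrix.of_apply]
    split_ifs
    · field_simp
    · simp
  rw [evolution_coinM_mulVec_apply]
  simp only [momentumEvolution, Matrix.mulVec, dotProduct, Matrix.of_apply, hA, sub_eq_add_neg x,
    AddChar.map_add_eq_mul, ← Finset.mul_sum, mul_assoc, sub_mul, ite_mul, one_mul, zero_mul,
    Finset.sum_sub_distrib, Finset.sum_ite_eq, Finset.mem_univ, if_true]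
  ring

theorem momentumEvolution_pow_eq_one {L N : ℕ} [NeZero N] {n : ℕ}
    (h : evolution N (coinM L) ^ n = 1) : momentumEvolution L N ^ n = 1 := by
  have key : ∀ (n : ℕ) (v : Fin L → ℂ),
      evolution N (coinM L) ^ n *ᵥ (fun p => ZMod.stdAddChar p.1 * v p.2) =
        fun p => ZMod.stdAddChar p.1 * (momentumEvolution L N ^ n *ᵥ v) p.2 := by
    intro n
    induction n with
    | zero => intro v; simp
    | succ n ih =>
      intro v
      rw [pow_succ, ← Matrix.mulVec_mulVec, evolution_mulVec_planeWave, ih, pow_succ,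
        ← Matrix.mulVec_mulVec]
  refine Matrix.ext_of_mulVec_single fun j => ?_
  have := key n (Pi.single j 1)
  rw [h, Matrix.one_mulVec] at this
  ext i
  simpa [Matrix.one_apply, Pi.single_apply] using (congrFun this (0, i)).symm

/-! ### Integrality obstruction when `N ∤ L`. -/

theorem isIntegral_trace_of_pow_eq_one {ι : Type*} [Fintype ι] [DecidableEq ι]
    {B : Matrix ι ι ℂ} {n : ℕ} (hn : 1 ≤ n) (h : B ^ n = 1) : IsIntegral ℤ B.trace := by
  rw [Matrix.trace_eq_sum_roots_charpoly]
  refine IsIntegral.multiset_sum fun μ hμ => ?_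
  rw [Polynomial.mem_roots (Matrix.charpoly_monic B).ne_zero,
    ← Matrix.mem_spectrum_iff_isRoot_charpoly] at hμ
  refine IsIntegral.of_pow hn ?_
  have h1 := spectrum.pow_mem_pow B n hμ
  have : Nontrivial (Matrix ι ι ℂ) := by
    by_contra hc
    rw [not_nontrivial_iff_subsingleton] at hc
    rw [spectrum.of_subsingleton] at hμ
    exact hμ
  rw [h, spectrum.one_eq] at h1
  rw [Set.mem_singleton_iff.mp h1]
  exact isIntegral_one

theorem isIntegral_stdAddChar {N : ℕ} [NeZero N] (a : ZMod N) :
    IsIntegral ℤ (ZMod.stdAddChar a : ℂ) := by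
  refine IsIntegral.of_pow (NeZero.pos N) ?_
  rw [← AddChar.map_nsmul_eq_pow]
  simp [isIntegral_one]

/-- The coin has constant diagonal and the displacements are consecutive integers from `-(L - 1) /
2`, so the phases form a geometric progression. -/
theorem trace_momentumEvolution (L N : ℕ) [NeZero N] :
    (momentumEvolution L N).trace =
      (2 - (L : ℂ)) / L * (ZMod.stdAddChar ((((L - 1) / 2 : ℕ) : ZMod N)) *
        ∑ i ∈ Finset.range L, (ZMod.stdAddChar (-1 : ZMod N) : ℂ) ^ i) := by
  rw [Finset.sum_range, Finset.mul_sum, Finset.mul_sum, Matrix.trace]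
  refine Finset.sum_congr rfl fun i _ => ?_
  rw [← AddChar.map_nsmul_eq_pow, ← AddChar.map_add_eq_mul, mul_comm]
  simp only [Matrix.diag_apply, momentumEvolution, coinM, Matrix.of_apply, if_true]
  congr 2
  simp only [displacement, Int.cast_sub, Int.cast_natCast, neg_sub, nsmul_eq_mul]
  ring

/-- For an odd `L ≥ 3` and a root of unity `η ≠ 1`, the number `2 (1 - η) / L` is not an algebraic
integer. -/
theorem not_isIntegral_two_div_mul_one_sub {L M : ℕ} (hL : Odd L) (hL3 : 3 ≤ L) (hM : 2 ≤ M)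
    {η : ℂ} (hη : IsPrimitiveRoot η M) : ¬ IsIntegral ℤ (2 / (L : ℂ) * (1 - η)) := by
  intro h
  obtain ⟨n, rfl⟩ : ∃ n, M = n + 1 := ⟨M - 1, by omega⟩
  have hηint : IsIntegral ℤ η := hη.isIntegral (by omega)
  -- `1 - η` divides each `1 - η ^ (k + 1)` integrally. The product of the latter is `M = n + 1`, so
  -- `L ^ n ∣ n + 1`, which is too large a divisor.
  have hj : ∀ k ∈ Finset.range n, IsIntegral ℤ (2 / (L : ℂ) * (1 - η ^ (k + 1))) := by
    intro k _
    rw [← mul_neg_geom_sum, ← mul_assoc]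
    exact h.mul (IsIntegral.sum _ fun i _ => hηint.pow i)
  have hprod := IsIntegral.prod _ hj
  rw [Finset.prod_mul_distrib, hη.prod_one_sub_pow_eq_order, Finset.prod_const,
    Finset.card_range] at hprod
  have hL0 : (L : ℂ) ≠ 0 := Nat.cast_ne_zero.mpr (by omega)
  have hq : (2 / (L : ℂ)) ^ n * ((n : ℂ) + 1) =
      algebraMap ℚ ℂ ((2 / (L : ℚ)) ^ n * ((n : ℚ) + 1)) := by simp
  rw [hq, isIntegral_algebraMap_iff (algebraMap ℚ ℂ).injective,
    IsIntegrallyClosed.isIntegral_iff] at hprod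
  obtain ⟨y, hy⟩ := hprod
  have hLq : (L : ℚ) ≠ 0 := Nat.cast_ne_zero.mpr (by omega)
  have hy' : (L : ℤ) ^ n * y = 2 ^ n * (n + 1) := by
    have : (L : ℚ) ^ n * (y : ℚ) = 2 ^ n * (n + 1) := by
      have hy2 : (y : ℚ) = (2 / (L : ℚ)) ^ n * ((n : ℚ) + 1) := by simpa using hy
      rw [hy2, div_pow]
      field_simp
    exact_mod_cast this
  have hdvd : L ^ n ∣ 2 ^ n * (n + 1) := by
    have : ((L ^ n : ℕ) : ℤ) ∣ ((2 ^ n * (n + 1) : ℕ) : ℤ) := ⟨y, by push_cast; exact hy'.symm⟩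
    exact_mod_cast this
  have hcop : Nat.Coprime (L ^ n) (2 ^ n) :=
    Nat.Coprime.pow _ _ (Nat.coprime_two_right.mpr hL)
  have hle := Nat.le_of_dvd (Nat.succ_pos n) (hcop.dvd_of_dvd_mul_left hdvd)
  have h3 : n + 1 < 3 ^ n := by
    clear * - hM
    obtain ⟨k, rfl⟩ : ∃ k, n = k + 1 := ⟨n - 1, by omega⟩
    clear hM
    induction k with
    | zero => norm_num
    | succ k ih => rw [pow_succ]; omega
  exact absurd (hle.trans_lt h3) (not_lt.mpr (Nat.pow_le_pow_left hL3 n))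

theorem evolution_pow_ne_one {L N : ℕ} [NeZero N] (hL : Odd L) (hL3 : 3 ≤ L) (hN : ¬ N ∣ L)
    {n : ℕ} (hn : 1 ≤ n) : evolution N (coinM L) ^ n ≠ 1 := by
  intro h
  have htr := isIntegral_trace_of_pow_eq_one hn (momentumEvolution_pow_eq_one h)
  rw [trace_momentumEvolution] at htr
  set ω : ℂ := ZMod.stdAddChar (-1 : ZMod N) with hω
  set a : ZMod N := (((L - 1) / 2 : ℕ) : ZMod N)
  have hωint : IsIntegral ℤ ω := isIntegral_stdAddChar _
  have hL0 : (L : ℂ) ≠ 0 := Nat.cast_ne_zero.mpr (by omega)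
  have hη1 : ω ^ L ≠ 1 := by
    rw [hω, ← AddChar.map_nsmul_eq_pow, ← AddChar.map_zero_eq_one (ZMod.stdAddChar (N := N))]
    intro h0
    have := ZMod.injective_stdAddChar h0
    apply hN
    rw [← ZMod.natCast_eq_zero_iff]
    simpa using this
  have hηN : (ω ^ L) ^ N = 1 := by
    rw [hω, ← AddChar.map_nsmul_eq_pow, ← AddChar.map_nsmul_eq_pow]
    simp
  have hpos : 0 < orderOf (ω ^ L) := orderOf_pos_iff.mpr
    (isOfFinOrder_iff_pow_eq_one.mpr ⟨N, NeZero.pos N, hηN⟩)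
  have hne : orderOf (ω ^ L) ≠ 1 := fun h1 => hη1 (orderOf_eq_one_iff.mp h1)
  refine not_isIntegral_two_div_mul_one_sub hL hL3 (by omega) (IsPrimitiveRoot.orderOf (ω ^ L)) ?_
  have hchar : (ZMod.stdAddChar (-a) : ℂ) * ZMod.stdAddChar a = 1 := by
    rw [← AddChar.map_add_eq_mul]; simp
  have hS : IsIntegral ℤ (∑ i ∈ Finset.range L, ω ^ i) := IsIntegral.sum _ fun i _ => hωint.pow i
  have hsum := ((isIntegral_stdAddChar (-a)).mul htr).add hS
  -- Since `(2 - L) / L + 1 = 2 / L`, adding one geometric sum to the unphased trace leaves `2 / L`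
  -- times it; the factor `1 - ω` telescopes.
  have hkey : 2 / (L : ℂ) * (1 - ω ^ L) = (1 - ω) * (ZMod.stdAddChar (-a) *
      ((2 - (L : ℂ)) / L * (ZMod.stdAddChar a * ∑ i ∈ Finset.range L, ω ^ i)) +
        ∑ i ∈ Finset.range L, ω ^ i) := by
    rw [← mul_neg_geom_sum]
    field_simp
    linear_combination (-(2 - (L : ℂ)) * (1 - ω) * ∑ i ∈ Finset.range L, ω ^ i) * hchar
  rw [hkey]
  exact (isIntegral_one.sub hωint).mul hsum

/-! ### Explicit dynamics when `N = L`. -/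

/-- The joint plane waves in position and chirality, for a walk with as many states as vertices. -/
noncomputable def doubleWave (L : ℕ) [NeZero L] (k r : ZMod L) : ZMod L × Fin L → ℂ :=
  fun p => ZMod.stdAddChar (k * p.1 - r * (displacement L p.2 : ZMod L))

theorem displacement_bijective (L : ℕ) [NeZero L] :
    Function.Bijective fun i : Fin L => (displacement L i : ZMod L) := by
  rw [Fintype.bijective_iff_injective_and_card]
  refine ⟨fun i j hij => ?_, by simp [ZMod.card]⟩
  simp only [displacement, Int.cast_sub, Int.cast_natCast, sub_left_inj] at hij
  rw [ZMod.natCast_eq_natCast_iff] at hij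
  exact Fin.ext (Nat.ModEq.eq_of_lt_of_lt hij i.2 j.2)

theorem sum_stdAddChar_mul (L : ℕ) [NeZero L] (r : ZMod L) :
    ∑ x : ZMod L, (ZMod.stdAddChar (r * x) : ℂ) = if r = 0 then (L : ℂ) else 0 := by
  have := AddChar.sum_mulShift r (ZMod.isPrimitive_stdAddChar L)
  simp only [ZMod.card] at this
  simp only [mul_comm r, this]
  split_ifs <;> simp

/-- The sum over chiralities vanishes unless `r = 0`, so the coin acts by a sign; translation by `d`
contributes the phase `e(-k d)`, which moves `r` to `r + k`. -/
theorem evolution_mulVec_doubleWave (L : ℕ) [NeZero L] (k r : ZMod L) :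
    evolution L (coinM L) *ᵥ doubleWave L k r =
      (if r = 0 then (1 : ℂ) else -1) • doubleWave L k (r + k) := by
  have hL : (L : ℂ) ≠ 0 := Nat.cast_ne_zero.mpr (NeZero.ne L)
  ext ⟨x, i⟩
  have hs : ∑ j, doubleWave L k r (x - (displacement L i : ZMod L), j) =
      ZMod.stdAddChar (k * (x - (displacement L i : ZMod L))) * if r = 0 then (L : ℂ) else 0 := by
    simp only [doubleWave, sub_eq_add_neg _ (r * _), AddChar.map_add_eq_mul, ← Finset.mul_sum]
    congr 1
    have hr := sum_stdAddChar_mul L (-r)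
    rw [← (displacement_bijective L).sum_comp fun y => (ZMod.stdAddChar (-r * y) : ℂ)] at hr
    simpa only [neg_mul, neg_eq_zero] using hr
  rw [evolution_coinM_mulVec_apply, hs]
  simp only [doubleWave, Pi.smul_apply, smul_eq_mul]
  have harg : k * (x - (displacement L i : ZMod L)) - r * (displacement L i : ZMod L) =
      k * x - (r + k) * (displacement L i : ZMod L) := by ring
  rw [harg]
  split_ifs with h
  · subst h
    rw [show k * (x - (displacement L i : ZMod L)) =
      k * x - (0 + k) * (displacement L i : ZMod L) by ring]
    field_simp
    ring
  · ring

theorem evolution_pow_mulVec_doubleWave (L : ℕ) [NeZero L] (k : ZMod L) (n : ℕ) (r : ZMod L) :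
    ∃ s : ℂ, s * s = 1 ∧ evolution L (coinM L) ^ n *ᵥ doubleWave L k r =
      s • doubleWave L k (r + n * k) := by
  induction n generalizing r with
  | zero => exact ⟨1, by simp, by simp⟩
  | succ n ih =>
    obtain ⟨s, hs, h⟩ := ih (r + k)
    refine ⟨(if r = 0 then (1 : ℂ) else -1) * s, ?_, ?_⟩
    · split_ifs <;> simp [hs]
    · rw [pow_succ, ← Matrix.mulVec_mulVec, evolution_mulVec_doubleWave, Matrix.mulVec_smul, h,
        smul_smul]
      congr 2
      push_cast
      ring

/-- Fourier inversion in both variables: the double waves span. -/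
theorem eq_one_of_mulVec_doubleWave {L : ℕ} [NeZero L]
    {B : Matrix (ZMod L × Fin L) (ZMod L × Fin L) ℂ}
    (h : ∀ k r, B *ᵥ doubleWave L k r = doubleWave L k r) : B = 1 := by
  have hL : (L : ℂ) ≠ 0 := Nat.cast_ne_zero.mpr (NeZero.ne L)
  have hsingle : ∀ q : ZMod L × Fin L, (Pi.single q 1 : ZMod L × Fin L → ℂ) =
      ∑ k : ZMod L, ∑ r : ZMod L, (((L : ℂ) * L)⁻¹ *
        ZMod.stdAddChar (r * (displacement L q.2 : ZMod L) - k * q.1)) • doubleWave L k r := by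
    rintro ⟨y, j⟩
    ext ⟨x, i⟩
    have hterm : ∀ k r : ZMod L, (((L : ℂ) * L)⁻¹ *
        ZMod.stdAddChar (r * (displacement L j : ZMod L) - k * y)) * doubleWave L k r (x, i) =
        ((L : ℂ) * L)⁻¹ * (ZMod.stdAddChar ((x - y) * k) *
          ZMod.stdAddChar (((displacement L j : ZMod L) - (displacement L i : ZMod L)) * r)) := by
      intro k r
      rw [doubleWave, mul_assoc, ← AddChar.map_add_eq_mul, ← AddChar.map_add_eq_mul]
      congr 2
      ring
    simp only [Finset.sum_apply, Pi.smul_apply, smul_eq_mul, hterm, ← Finset.mul_sum]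
    rw [← Finset.sum_mul, sum_stdAddChar_mul, sum_stdAddChar_mul]
    have hd : (displacement L j : ZMod L) - (displacement L i : ZMod L) = 0 ↔ i = j := by
      rw [sub_eq_zero, eq_comm]
      exact (displacement_bijective L).1.eq_iff
    simp only [sub_eq_zero (a := x), hd, Pi.single_apply, Prod.mk.injEq]
    by_cases h1 : x = y <;> by_cases h2 : i = j <;> simp [h1, h2]
    field_simp
  refine Matrix.ext_of_mulVec_single fun q => ?_
  rw [Matrix.one_mulVec, hsingle, Matrix.mulVec_sum]
  refine Finset.sum_congr rfl fun k _ => ?_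
  rw [Matrix.mulVec_sum]
  refine Finset.sum_congr rfl fun r _ => ?_
  rw [Matrix.mulVec_smul, h]

theorem evolution_pow_two_mul_eq_one (L : ℕ) [NeZero L] :
    evolution L (coinM L) ^ (2 * L) = 1 := by
  refine eq_one_of_mulVec_doubleWave fun k r => ?_
  obtain ⟨s, hs, h⟩ := evolution_pow_mulVec_doubleWave L k L r
  simp only [CharP.cast_eq_zero, zero_mul, add_zero] at h
  rw [two_mul, pow_add, ← Matrix.mulVec_mulVec, h, Matrix.mulVec_smul, h, smul_smul, hs, one_smul]

theorem two_mul_dvd_of_evolution_pow_eq_one {L : ℕ} [NeZero L] (hL : Odd L) (hL3 : 3 ≤ L) {n : ℕ}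
    (h : evolution L (coinM L) ^ n = 1) : 2 * L ∣ n := by
  have : Fact (1 < L) := ⟨by omega⟩
  refine Nat.Coprime.mul_dvd_of_dvd_of_dvd (Nat.coprime_two_left.mpr hL) ?_ ?_
  -- An eigenvector for `-1` forces `n` to be even.
  · have hpow : ∀ n : ℕ, evolution L (coinM L) ^ n *ᵥ doubleWave L 0 1 =
        (-1 : ℂ) ^ n • doubleWave L 0 1 := by
      intro n
      induction n with
      | zero => simp
      | succ n ih =>
        rw [pow_succ, ← Matrix.mulVec_mulVec, evolution_mulVec_doubleWave, if_neg one_ne_zero,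
          add_zero, Matrix.mulVec_smul, ih, smul_smul, pow_succ, mul_comm]
    have h1 := hpow n
    rw [h, Matrix.one_mulVec] at h1
    obtain ⟨i, hi⟩ := (displacement_bijective L).2 0
    have h2 := congrFun h1 (0, i)
    simp only [doubleWave, Pi.smul_apply, smul_eq_mul, hi, mul_zero, sub_zero,
      AddChar.map_zero_eq_one, mul_one] at h2
    rw [← even_iff_two_dvd]
    by_contra hodd
    rw [Nat.not_even_iff_odd] at hodd
    rw [hodd.neg_one_pow] at h2
    norm_num at h2
  -- Displacement `0` gives `s = 1`; displacement `-1` then gives `e(n) = 1`, so `L ∣ n`.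
  · obtain ⟨s, -, h1⟩ := evolution_pow_mulVec_doubleWave L 1 n 0
    rw [h, Matrix.one_mulVec] at h1
    obtain ⟨i, hi⟩ := (displacement_bijective L).2 0
    obtain ⟨j, hj⟩ := (displacement_bijective L).2 (-1)
    have h2 := congrFun h1 (0, i)
    have h3 := congrFun h1 (0, j)
    simp only at hi hj
    simp only [doubleWave, Pi.smul_apply, smul_eq_mul, hi, hj, mul_zero, zero_mul, sub_zero,
      AddChar.map_zero_eq_one, mul_one] at h2 h3
    rw [← h2, one_mul, ← AddChar.map_zero_eq_one (ZMod.stdAddChar (N := L))] at h3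
    have h4 := ZMod.injective_stdAddChar h3
    rw [← ZMod.natCast_eq_zero_iff]
    simpa using h4.symm

end GroverWalk

/-- The period of the M-type Grover walk with a prime number `L ≥ 3` of states on the cycle with
`N ≥ 2` vertices is `2 L` if `N = L`, and infinite otherwise. -/
theorem theorem4p1 (L : ℕ) (hL : L.Prime) (hL3 : 3 ≤ L) (N : ℕ) [NeZero N] (hN : 2 ≤ N) :
    GroverWalk.periodM L N = if N = L then ((2 * L : ℕ) : ℕ∞) else ⊤ := by
  have hodd : Odd L := hL.odd_of_ne_two (by omega)
  unfold GroverWalk.periodM GroverWalk.period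
  split_ifs with h
  · subst h
    refine le_antisymm (sInf_le ⟨2 * N, ⟨by omega, GroverWalk.evolution_pow_two_mul_eq_one N⟩, rfl⟩)
      (le_sInf ?_)
    rintro _ ⟨n, ⟨hn, hU⟩, rfl⟩
    exact Nat.cast_le.mpr
      (Nat.le_of_dvd hn (GroverWalk.two_mul_dvd_of_evolution_pow_eq_one hodd hL3 hU))
  · have hdvd : ¬ N ∣ L := fun hd => by
      rcases (Nat.dvd_prime hL).mp hd with h1 | h1
      · omega
      · exact h h1
    rw [sInf_eq_top]
    rintro _ ⟨n, ⟨hn, hU⟩, rfl⟩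
    exact absurd hU (GroverWalk.evolution_pow_ne_one hodd hL3 hdvd hn)
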